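/- Conventions. A variety over a field \(k\) is an integral scheme that is separated and of finite type over \(k\); a scheme is normal if all its local rings are integrally closed domains. A scheme \(X\) over \(k\) is geometrically normal (resp. geometrically reduced) over \(k\) if \(X \times_k K\) is normal (resp. reduced) for every field extension \(k \subset K\). Let \(k\) be a field of characteristic \(p > 0\) and let \(X\) be a variety over \(k\) such that \(k\) is algebraically closed in the function field \(K(X)\). An elemental extension \((k \subset l \subset k',\ \varphi : X' \to X)\) of \((k, X)\) consists of field extensions \(k \subset l \subset k'\) and a morphism of schemes \(\varphi : X' \to X\) such that: \(k \subset l\) is purely inseparable with \(l^p \subset k\); \(X \times_k l\) is integral; \(X'\) is the normalisation of \(X \times_k l\) and \(\varphi\) is the induced morphism \(X' \to X \times_k l \to X\); and \(k'\) is the algebraic closure of \(l\) in \(K(X')\). In particular \(X'\) is a scheme over \(k'\). Theorem. Let \(k_0\) be a field of characteristic \(p > 0\) and let \(X_0\) be a normal variety over \(k_0\) such that \(k_0\) is algebraically closed in \(K(X_0)\). Let \(n \geq 0\) and, for each \(i \in \{1, \dots, n\}\), let \((k_{i-1} \subset l_i \subset k_i,\ \varphi_i : X_i \to X_{i-1})\)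 be an elemental extension of \((k_{i-1}, X_{i-1})\). (1) Assume that \(X_n\) is geometrically normal over \(k_n\). Then the following are equivalent: (a) \(X_0\) is geometrically normal over \(k_0\); (b) \(X_{i-1} \times_{k_{i-1}} l_i\) is normal and \(l_i = k_i\) for every \(i \in \{1, \dots, n\}\). If moreover \(X_0\) is proper over \(k_0\), then each of (a) and (b) is equivalent to (c) \(X_{i-1} \times_{k_{i-1}} l_i\) is normal for every \(i \in \{1, \dots, n\}\). (2) Assume that \(X_n\) is geometrically reduced over \(k_n\). Then the following are equivalent: (a') \(X_0\) is geometrically reduced over \(k_0\); (b') \(l_i = k_i\) for every \(i \in \{1, \dots, n\}\). -/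

import Mathlib

open CategoryTheory CategoryTheory.Limits AlgebraicGeometry

universe u

noncomputable section

namespace ElementalExt

/-- A scheme is normal if all its local rings are integrally closed domains. -/
def IsNormalScheme (X : Scheme.{u}) : Prop :=
  ∀ x : X, IsDomain (X.presheaf.stalk x) ∧ IsIntegrallyClosed (X.presheaf.stalk x)

/-- The canonical morphism `Spec K(X) ⟶ X` of an irreducible scheme. -/
abbrev fromSpecFunctionField (X : Scheme.{u}) [IrreducibleSpace X] :
    Spec X.functionField ⟶ X :=
  X.fromSpecStalk (genericPoint X)

instance (X : Scheme.{u}) [IsIntegral X] : QuasiCompact (fromSpecFunctionField X) := by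
  refine ⟨fun U _ _ ↦ ?_⟩
  have : Subsingleton (Spec X.functionField) :=
    inferInstanceAs (Subsingleton (PrimeSpectrum X.functionField))
  exact (Set.toFinite _).isCompact

instance (X : Scheme.{u}) [IsIntegral X] : QuasiSeparated (fromSpecFunctionField X) := by
  infer_instance

/-- The normalisation of an integral scheme `Y`: the normalisation of `Y` in its generic point
`Spec K(Y)`, i.e. over an affine open `U` it is the spectrum of the integral closure of `Γ(Y, U)`
in the function field `K(Y)`. -/
def normalisation (Y : Scheme.{u}) [IsIntegral Y] : Scheme.{u} :=
  (fromSpecFunctionField Y).normalization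

/-- The structure morphism of the normalisation. -/
def fromNormalisation (Y : Scheme.{u}) [IsIntegral Y] : normalisation Y ⟶ Y :=
  (fromSpecFunctionField Y).fromNormalization

instance (Y : Scheme.{u}) [IsIntegral Y] : IsIntegral (normalisation Y) :=
  inferInstanceAs (IsIntegral (fromSpecFunctionField Y).normalization)

/-- `ν : X' ⟶ Y` is (isomorphic over `Y` to) the normalisation of the integral scheme `Y`. -/
def IsNormalisation {X' Y : Scheme.{u}} [IsIntegral Y] (ν : X' ⟶ Y) : Prop :=
  ∃ e : X' ≅ normalisation Y, e.hom ≫ fromNormalisation Y = ν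

lemma IsNormalisation.isIntegral {X' Y : Scheme.{u}} [IsIntegral Y] {ν : X' ⟶ Y}
    (h : IsNormalisation ν) : IsIntegral X' := by
  obtain ⟨e, -⟩ := h
  have : Nonempty X' := ⟨e.inv (genericPoint (normalisation Y))⟩
  exact isIntegral_of_isOpenImmersion e.hom

/-- The ring homomorphism `k →+* K(X)` induced by `α : X ⟶ Spec k`. -/
def toFunctionField {k : Type u} [Field k] {X : Scheme.{u}} [IsIntegral X]
    (α : X ⟶ Spec (.of k)) : k →+* X.functionField :=
  (X.presheaf.germ ⊤ (genericPoint X) trivial).hom.comp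
    (α.appTop.hom.comp (Scheme.ΓSpecIso (.of k)).inv.hom)

/-- For a homomorphism of fields `f : k →+* K`, the algebraic closure of `k` in `K`. -/
def algClosureIn {k K : Type u} [Field k] [Field K] (f : k →+* K) : Subfield K :=
  letI := f.toAlgebra
  (algebraicClosure k K).toSubfield

/-- A variety over `k`: an integral scheme, separated and of finite type over `k`. -/
structure IsVariety {k : Type u} [Field k] {X : Scheme.{u}} (α : X ⟶ Spec (.of k)) : Prop where
  isIntegral : IsIntegral X
  isSeparated : IsSeparated α
  quasiCompact : QuasiCompact α
  locallyOfFiniteType : LocallyOfFiniteType α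

/-- `α : X ⟶ Spec k` is a variety over `k` such that `k` is algebraically closed in `K(X)`. -/
structure IsVarietyWithClosedBase {k : Type u} [Field k] {X : Scheme.{u}}
    (α : X ⟶ Spec (.of k)) : Prop extends IsVariety α where
  algClosed : (toFunctionField α).fieldRange = algClosureIn (toFunctionField α)

/-- The base change `X ×ₖ l` of `α : X ⟶ Spec k` along a field extension `k ⊂ l`. -/
abbrev baseChange {k : Type u} [Field k] {X : Scheme.{u}} (α : X ⟶ Spec (.of k))
    (l : Type u) [Field l] [Algebra k l] : Scheme.{u} :=
  pullback α (Spec.map (CommRingCat.ofHom (algebraMap k l)))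

/-- `(k ⊂ l ⊂ k', φ : X' ⟶ X)` is an elemental extension of `(k, X)`, where `k` has
characteristic `p`, and `α : X ⟶ Spec k` and `α' : X' ⟶ Spec k'` are the structure morphisms. -/
structure IsElementalExtension (p : ℕ) {k l k' : Type u} [Field k] [Field l] [Field k']
    [Algebra k l] [Algebra l k'] {X X' : Scheme.{u}} (α : X ⟶ Spec (.of k))
    (α' : X' ⟶ Spec (.of k')) (φ : X' ⟶ X) : Prop where
  /-- `X` is a variety over `k` and `k` is algebraically closed in `K(X)`. -/
  isVarietyWithClosedBase : IsVarietyWithClosedBase α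
  /-- `k ⊂ l` is purely inseparable. -/
  isPurelyInseparable : IsPurelyInseparable k l
  /-- `l ^ p ⊂ k`. -/
  pow_mem : ∀ x : l, x ^ p ∈ (algebraMap k l).range
  /-- `X ×ₖ l` is integral. -/
  isIntegral_baseChange : IsIntegral (baseChange α l)
  /-- The square formed by `φ`, `α`, `α'` and `k ⊂ k'` commutes. -/
  comm : φ ≫ α = (α' ≫ Spec.map (CommRingCat.ofHom (algebraMap l k'))) ≫
    Spec.map (CommRingCat.ofHom (algebraMap k l))
  /-- The morphism `X' ⟶ X ×ₖ l` with components `φ` and `X' ⟶ Spec k' ⟶ Spec l` is the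
  normalisation of `X ×ₖ l`. -/
  isNormalisation : IsNormalisation
    (pullback.lift φ (α' ≫ Spec.map (CommRingCat.ofHom (algebraMap l k'))) comm :
      X' ⟶ baseChange α l)
  /-- `k'` is the algebraic closure of `l` in `K(X')`. -/
  algClosure :
    haveI := isNormalisation.isIntegral
    (toFunctionField α').fieldRange =
      algClosureIn (toFunctionField (α' ≫ Spec.map (CommRingCat.ofHom (algebraMap l k'))))

/-- `α : X ⟶ Spec k` is geometrically normal: `X ×ₖ K` is normal for every field extension
`k ⊂ K`. -/
def GeometricallyNormal {k : Type u} [Field k] {X : Scheme.{u}} (α : X ⟶ Spec (.of k)) : Prop :=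
  geometrically (fun Y : Scheme.{u} ↦ IsNormalScheme Y) α

end ElementalExt

end

/-! Everything reduces to one elemental step `k ⊂ l ⊂ k'`, followed by induction along the tower.
The key point is that geometric reducedness of `X` forces `l = k'`. With `K = K(X)`, the field `F =
K(X ×ₖ l)` is generated over `K` by `l`, so `F ^ p ⊆ K`; hence `k' ^ p` lies in `K` and is algebraic
over `k`, so it lies in `k`. The kernel of `K ⊗[k] k' → F` is then nilpotent, hence zero, while `K
⊗[k] l` already maps onto `F`. So `K ⊗[k] l → K ⊗[k] k'` is onto, and so is `l → k'`
(`algebraMap_surjective_of_isReduced_tensorProduct`, `surjective_of_geometricallyReduced`). If `l =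
k'` and `X ×ₖ l` is normal, then `X'` is `X ×ₖ l`, and geometric normality passes up by base change
and down by flat descent (`geometricallyNormal_iff`). Without normality, geometric reducedness still
passes both ways, because it can be tested at the generic point, which normalisation does not change
(`geometricallyReduced_iff`). In the proper case `Γ(X) = k`, so normality of `X ×ₖ l` gives `Γ(X') =
l`, and `k'` embeds in `Γ(X')` (`surjective_of_isNormalScheme_baseChange`). -/

noncomputable section

namespace ElementalExt

open TensorProduct

/-! ### Field theory of one elemental step -/

/-- Let `F` be generated by `l` over a field `K` in which `k` is algebraically closed, and let `k'`
be an algebraic extension of `l` in `F`. If `l ^ p ⊆ k` and `K ⊗[k] k'` is reduced, then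
`l = k'`. -/
theorem algebraMap_surjective_of_isReduced_tensorProduct (p : ℕ) [Fact p.Prime]
    {k l k' K F : Type*} [Field k] [Field l] [Field k'] [Field K] [Field F] [CharP k p]
    [Algebra k l] [Algebra l k'] [Algebra k k'] [IsScalarTower k l k'] [Algebra k K]
    [Algebra k F] [Algebra K F] [Algebra k' F] [Algebra l F]
    [IsScalarTower k K F] [IsScalarTower k k' F] [IsScalarTower l k' F]
    [Algebra.IsAlgebraic l k']
    (hadj : Algebra.adjoin K (Set.range (algebraMap l F)) = ⊤)
    (hpow : ∀ x : l, x ^ p ∈ (algebraMap k l).range)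
    (hclosed : ∀ x : K, IsAlgebraic k x → x ∈ (algebraMap k K).range)
    [IsReduced (K ⊗[k] k')] :
    Function.Surjective (algebraMap l k') := by
  have : CharP F p := charP_of_injective_algebraMap (algebraMap k F).injective p
  have : CharP (K ⊗[k] k') p :=
    charP_of_injective_algebraMap (algebraMap k (K ⊗[k] k')).injective p
  have : IsScalarTower k l F := .to₁₂₄ k l k' F
  have hlk : Algebra.IsAlgebraic k l := ⟨fun x ↦ by
    obtain ⟨c, hc⟩ := hpow x
    exact (hc ▸ isAlgebraic_algebraMap c : IsAlgebraic k (x ^ p)).of_pow (Fact.out : p.Prime).pos⟩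
  have : Algebra.IsAlgebraic k k' := .trans k l k'
  have hF (z : F) : z ^ p ∈ (algebraMap K F).range := by
    have hz : z ∈ Algebra.adjoin K (Set.range (algebraMap l F)) := hadj ▸ trivial
    induction hz using Algebra.adjoin_induction with
    | mem z hz =>
      obtain ⟨y, rfl⟩ := hz
      obtain ⟨c, hc⟩ := hpow y
      exact ⟨algebraMap k K c, by rw [← map_pow, ← hc, ← IsScalarTower.algebraMap_apply,
        ← IsScalarTower.algebraMap_apply]⟩
    | algebraMap r => exact ⟨r ^ p, map_pow _ _ _⟩
    | add y z _ _ hy hz => rw [add_pow_char]; exact add_mem hy hz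
    | mul y z _ _ hy hz => rw [mul_pow]; exact mul_mem hy hz
  have hk' (x : k') : ∃ c : k, algebraMap k k' c = x ^ p := by
    obtain ⟨y, hy⟩ := hF (algebraMap k' F x)
    obtain ⟨c, rfl⟩ := hclosed y <| by
      rw [← isAlgebraic_algebraMap_iff (algebraMap K F).injective, hy, ← map_pow]
      exact (Algebra.IsAlgebraic.isAlgebraic (x ^ p)).algebraMap
    refine ⟨c, (algebraMap k' F).injective ?_⟩
    rw [map_pow, ← hy, ← IsScalarTower.algebraMap_apply, ← IsScalarTower.algebraMap_apply]
  -- Since `x ^ p` lies in `k`, it can be moved across the tensor sign.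
  have hT (z : K ⊗[k] k') : ∃ y : K, y ⊗ₜ 1 = z ^ p := by
    induction z with
    | zero => exact ⟨0, by simp [(Fact.out : p.Prime).ne_zero]⟩
    | tmul a x =>
      obtain ⟨c, hc⟩ := hk' x
      exact ⟨c • a ^ p, by rw [Algebra.TensorProduct.tmul_pow, ← hc, TensorProduct.smul_tmul,
        Algebra.algebraMap_eq_smul_one]⟩
    | add y z hy hz =>
      obtain ⟨a, ha⟩ := hy
      obtain ⟨b, hb⟩ := hz
      exact ⟨a + b, by rw [add_pow_char, ← ha, ← hb, TensorProduct.add_tmul]⟩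
  let m : K ⊗[k] k' →ₐ[K] F := Algebra.TensorProduct.lift (Algebra.ofId K F)
    (IsScalarTower.toAlgHom k k' F) fun _ _ ↦ .all _ _
  -- For `z` in the kernel, `z ^ p` comes from `K`, which injects into `F`; so `z ^ p = 0`, and
  -- reducedness gives `z = 0`.
  have hm : Function.Injective m := by
    rw [injective_iff_map_eq_zero]
    intro z hz
    obtain ⟨y, hy⟩ := hT z
    have : m (y ⊗ₜ 1) = 0 := by rw [hy, map_pow, hz, zero_pow (Fact.out : p.Prime).ne_zero]
    have hy0 : y = 0 := by simpa [m, Algebra.ofId_apply] using this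
    rw [hy0, TensorProduct.zero_tmul] at hy
    exact eq_zero_of_pow_eq_zero hy.symm
  let g : K ⊗[k] l →ₐ[K] K ⊗[k] k' :=
    Algebra.TensorProduct.map (.id K K) (IsScalarTower.toAlgHom k l k')
  have hmg : (m.comp g).range = ⊤ := by
    rw [eq_top_iff, ← hadj, Algebra.adjoin_le_iff]
    rintro _ ⟨y, rfl⟩
    exact ⟨1 ⊗ₜ y, by simp [m, g, ← IsScalarTower.algebraMap_apply]⟩
  have hg : Function.Surjective g := fun z ↦ by
    obtain ⟨y, hy⟩ : m z ∈ (m.comp g).range := hmg ▸ trivial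
    exact ⟨y, hm hy⟩
  exact (Module.FaithfullyFlat.lTensor_surjective_iff_surjective k K
    (IsScalarTower.toAlgHom k l k').toLinearMap).mp hg

/-! ### Flat descent of normality and reducedness -/

/-- If `a / c` is integral over `A`, it is integral over `B`, so `c` divides `a` in `B`; faithful
flatness gives `cB ∩ A = cA`, so `c` divides `a` in `A`. -/
theorem isIntegrallyClosed_of_faithfullyFlat {A B : Type*} [CommRing A] [CommRing B] [Algebra A B]
    [Module.FaithfullyFlat A B] [IsDomain B] [IsIntegrallyClosed B] :
    IsDomain A ∧ IsIntegrallyClosed A := by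
  have hinj := FaithfulSMul.algebraMap_injective A B
  have : IsDomain A := hinj.isDomain
  refine ⟨this, ?_⟩
  rw [isIntegrallyClosed_iff (FractionRing A)]
  intro x hx
  have hinj' : Function.Injective (Algebra.ofId A (FractionRing B)) := by
    change Function.Injective (algebraMap A (FractionRing B))
    rw [IsScalarTower.algebraMap_eq A B (FractionRing B)]
    exact (IsFractionRing.injective B (FractionRing B)).comp hinj
  let f : FractionRing A →ₐ[A] FractionRing B := IsFractionRing.liftAlgHom hinj'
  obtain ⟨b, hb⟩ := IsIntegrallyClosed.isIntegral_iff.mp ((hx.map f).tower_top (A := B))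
  obtain ⟨a, c, hc, rfl⟩ := IsFractionRing.div_surjective (A := A) x
  have hc0 : algebraMap A B c ≠ 0 := fun h ↦
    nonZeroDivisors.ne_zero hc (hinj (by simpa using h))
  have hac : algebraMap A B a = b * algebraMap A B c := by
    apply IsFractionRing.injective B (FractionRing B)
    have h1 : f (algebraMap A _ c) ≠ 0 := by
      simpa using nonZeroDivisors.ne_zero hc
    rw [map_div₀, eq_div_iff h1] at hb
    simpa [← IsScalarTower.algebraMap_apply] using hb.symm
  have : a ∈ Ideal.span {c} := by
    rw [← Ideal.comap_map_eq_self_of_faithfullyFlat (B := B) (Ideal.span {c}), Ideal.mem_comap,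
      Ideal.map_span, Set.image_singleton, Ideal.mem_span_singleton']
    exact ⟨b, hac.symm⟩
  obtain ⟨d, rfl⟩ := Ideal.mem_span_singleton'.mp this
  exact ⟨d, by
    rw [map_mul, mul_div_cancel_right₀]
    simpa using nonZeroDivisors.ne_zero hc⟩

lemma faithfullyFlat_stalkMap {X Y : Scheme.{u}} (f : X ⟶ Y) [Flat f] (x : X) :
    (f.stalkMap x).hom.FaithfullyFlat := by
  algebraize [(f.stalkMap x).hom]
  exact @Module.FaithfullyFlat.of_flat_of_isLocalHom _ _ _ _ _ _ _
    (Flat.stalkMap f x) (f.toLRSHom.prop x)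

lemma isReduced_of_flat_of_surjective {X Y : Scheme.{u}} (f : X ⟶ Y) [Flat f] [Surjective f]
    [IsReduced X] : IsReduced Y := by
  have (y : Y) : _root_.IsReduced (Y.presheaf.stalk y) := by
    obtain ⟨x, rfl⟩ := f.surjective y
    exact isReduced_of_injective _ (faithfullyFlat_stalkMap f x).injective
  exact isReduced_of_isReduced_stalk _

/-- The stalk maps are surjective, and injective by faithful flatness, hence isomorphisms. This is
meant for base changes of `Spec K(X) ⟶ X`, which need not be open immersions. -/
lemma isReduced_of_flat_of_isPreimmersion {X Y : Scheme.{u}} (f : X ⟶ Y) [Flat f]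
    [IsPreimmersion f] [IsReduced Y] : IsReduced X := by
  have (x : X) : _root_.IsReduced (X.presheaf.stalk x) := by
    let e := RingEquiv.ofBijective (f.stalkMap x).hom
      ⟨(faithfullyFlat_stalkMap f x).injective, f.stalkMap_surjective x⟩
    exact isReduced_of_injective e.symm e.symm.injective
  exact isReduced_of_isReduced_stalk _

lemma IsNormalScheme.of_flat_of_surjective {X Y : Scheme.{u}} (f : X ⟶ Y) [Flat f] [Surjective f]
    (h : IsNormalScheme X) : IsNormalScheme Y := by
  intro y
  obtain ⟨x, rfl⟩ := f.surjective y
  algebraize [(f.stalkMap x).hom]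
  have : Module.FaithfullyFlat (Y.presheaf.stalk (f x)) (X.presheaf.stalk x) :=
    faithfullyFlat_stalkMap f x
  obtain ⟨_, _⟩ := h x
  exact isIntegrallyClosed_of_faithfullyFlat (B := X.presheaf.stalk x)

lemma IsNormalScheme.isReduced {X : Scheme.{u}} (h : IsNormalScheme X) : IsReduced X := by
  have (x : X) : _root_.IsReduced (X.presheaf.stalk x) :=
    have := (h x).1
    inferInstance
  exact isReduced_of_isReduced_stalk _

lemma IsNormalScheme.isIntegrallyClosed {X : Scheme.{u}} [IsIntegral X] (h : IsNormalScheme X)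
    {U : X.Opens} (hU : IsAffineOpen U) [Nonempty U] : IsIntegrallyClosed Γ(X, U) := by
  refine IsIntegrallyClosed.of_localization_maximal fun P _ _ ↦ ?_
  let y : PrimeSpectrum Γ(X, U) := ⟨P, inferInstance⟩
  have hy : hU.fromSpec y ∈ U := by
    rw [← SetLike.mem_coe, ← hU.range_fromSpec]
    exact ⟨y, rfl⟩
  let : Algebra Γ(X, U) (X.presheaf.stalk (hU.fromSpec y)) :=
    (X.presheaf.germ U _ hy).hom.toAlgebra
  have : IsLocalization P.primeCompl (X.presheaf.stalk (hU.fromSpec y)) :=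
    hU.isLocalization_stalk' y hy
  have := (h (hU.fromSpec y)).2
  exact .of_equiv (IsLocalization.algEquiv P.primeCompl (X.presheaf.stalk (hU.fromSpec y))
    (Localization.AtPrime P)).toRingEquiv

/-! ### Geometric properties over a field -/

instance {X : Scheme.{u}} (x : X) : Flat (X.fromSpecStalk x) := by
  obtain ⟨_, ⟨U, hU, rfl⟩, hxU, -⟩ :=
    X.isBasis_affineOpens.exists_subset_of_mem_open (Set.mem_univ x) isOpen_univ
  rw [← hU.fromSpecStalk_eq_fromSpecStalk hxU]
  change Flat (Spec.map (X.presheaf.germ U x hxU) ≫ hU.fromSpec)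
  have : Flat (Spec.map (X.presheaf.germ U x hxU)) := by
    rw [Flat.SpecMap_iff]
    let : Algebra Γ(X, U) (X.presheaf.stalk x) := (X.presheaf.germ U x hxU).hom.toAlgebra
    have := hU.isLocalization_stalk ⟨x, hxU⟩
    exact IsLocalization.flat (R := Γ(X, U)) (X.presheaf.stalk x)
      (hU.primeIdealOf ⟨x, hxU⟩).asIdeal.primeCompl
  have := hU.isOpenImmersion_fromSpec
  exact Flat.comp _ _

instance {k l : Type u} [Field k] [Field l] (f : CommRingCat.of k ⟶ .of l) :
    Surjective (Spec.map f) := by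
  have : Subsingleton (Spec (.of k)) := inferInstanceAs (Subsingleton (PrimeSpectrum k))
  have : Nonempty (Spec (.of l)) := inferInstanceAs (Nonempty (PrimeSpectrum l))
  exact ⟨Function.surjective_to_subsingleton _⟩

instance {k : Type u} [Field k] {X : Scheme.{u}} (f : X ⟶ Spec (.of k)) : Flat f := by
  have : Subsingleton (Spec (.of k)) := inferInstanceAs (Subsingleton (PrimeSpectrum k))
  infer_instance

/-- A property that descends along flat surjective morphisms holds geometrically for `α` as soon
as it holds geometrically for the base change of `α` to a field extension. -/
lemma geometrically_of_geometrically_snd {P : ObjectProperty Scheme.{u}}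
    (hP : ∀ {Z W : Scheme.{u}} (f : Z ⟶ W) [Flat f] [Surjective f], P Z → P W)
    {k l : Type u} [Field k] [Field l] [Algebra k l] {X : Scheme.{u}} (α : X ⟶ Spec (.of k))
    (h : geometrically P
      (pullback.snd α (Spec.map (CommRingCat.ofHom (algebraMap k l))))) :
    geometrically P α := by
  rw [geometrically_iff_of_commRing]
  intro K _ _ Z fst snd hZ
  -- A residue field of `K ⊗[k] l` is a common extension of `K` and `l`: the property holds over it
  -- because it contains `l`, then descends to `K`.
  obtain ⟨m, hm⟩ := Ideal.exists_maximal (K ⊗[k] l)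
  let := Ideal.Quotient.field m
  let i : CommRingCat.of K ⟶ .of (K ⊗[k] l ⧸ m) :=
    CommRingCat.ofHom ((Ideal.Quotient.mk m).comp Algebra.TensorProduct.includeLeftRingHom)
  let j : CommRingCat.of l ⟶ .of (K ⊗[k] l ⧸ m) :=
    CommRingCat.ofHom ((Ideal.Quotient.mk m).comp
      (Algebra.TensorProduct.includeRight : l →ₐ[k] K ⊗[k] l).toRingHom)
  have hij : Spec.map i ≫ Spec.map (CommRingCat.ofHom (algebraMap k K)) =
      Spec.map j ≫ Spec.map (CommRingCat.ofHom (algebraMap k l)) := by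
    rw [← Spec.map_comp, ← Spec.map_comp]
    congr 1
    ext x
    simp [i, j, Algebra.TensorProduct.algebraMap_apply, Algebra.TensorProduct.tmul_one_eq_one_tmul]
  have h1 := (IsPullback.of_hasPullback snd (Spec.map i)).paste_horiz hZ
  rw [hij] at h1
  have h2 : IsPullback (pullback.lift (pullback.fst snd (Spec.map i) ≫ fst)
      (pullback.snd snd (Spec.map i) ≫ Spec.map j) (by simpa using h1.w))
      (pullback.snd snd (Spec.map i))
      (pullback.snd α (Spec.map (CommRingCat.ofHom (algebraMap k l)))) (Spec.map j) :=
    IsPullback.of_right (by rwa [pullback.lift_fst]) (by rw [pullback.lift_snd])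
      (IsPullback.of_hasPullback α (Spec.map (CommRingCat.ofHom (algebraMap k l))))
  exact hP (pullback.fst snd (Spec.map i)) (h _ _ _ h2)

/-- Scheme-theoretic dominance of a quasi-compact morphism survives the flat base change to `K`, and
a scheme dominated in this sense by a reduced one is reduced. -/
lemma geometricallyReduced_of_isSchemeTheoreticallyDominant {k : Type u} [Field k]
    {Z X : Scheme.{u}} (f : Z ⟶ X) [IsSchemeTheoreticallyDominant f] [QuasiCompact f]
    (α : X ⟶ Spec (.of k)) [GeometricallyReduced (f ≫ α)] : GeometricallyReduced α := by
  refine ⟨fun K _ y W fst snd h ↦ ?_⟩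
  have : Flat fst := MorphismProperty.of_isPullback h.flip (by
    obtain ⟨y, rfl⟩ := Spec.map_surjective y
    infer_instance)
  have h' := IsPullback.of_hasPullback f fst
  have : IsReduced (pullback f fst) :=
    GeometricallyReduced.geometrically_isReduced (f := f ≫ α) _ _ _ (h'.flip.paste_horiz h.flip).flip
  exact IsSchemeTheoreticallyDominant.isReduced (pullback.snd f fst)

lemma geometricallyReduced_comp_of_flat_of_isPreimmersion {Z X Y : Scheme.{u}}
    (f : Z ⟶ X) [Flat f] [IsPreimmersion f] (α : X ⟶ Y) [GeometricallyReduced α] :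
    GeometricallyReduced (f ≫ α) := by
  refine ⟨fun K _ y W fst snd h ↦ ?_⟩
  have h' := (IsPullback.of_hasPullback f (pullback.fst α y)).flip.paste_horiz
    (IsPullback.of_hasPullback α y).flip
  have : IsReduced (pullback α y) :=
    GeometricallyReduced.geometrically_isReduced _ _ _ (.of_hasPullback α y)
  have : IsReduced (pullback f (pullback.fst α y)) :=
    isReduced_of_flat_of_isPreimmersion (pullback.snd f (pullback.fst α y))
  exact isReduced_of_isOpenImmersion (h.flip.isoIsPullback _ _ h').hom

/-! ### Normalisation and the generic point -/

lemma fromSpecStalk_appLE {X : Scheme.{u}} {x : X} {U : X.Opens} (hx : x ∈ U)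
    (h : ⊤ ≤ X.fromSpecStalk x ⁻¹ᵁ U) :
    (X.fromSpecStalk x).appLE U ⊤ h ≫ (Scheme.ΓSpecIso _).hom = X.presheaf.germ U x hx := by
  have : (Spec (X.presheaf.stalk x)).presheaf.map (homOfLE le_top).op ≫
      (Spec (X.presheaf.stalk x)).presheaf.map (homOfLE h).op = 𝟙 _ := by
    rw [← Functor.map_comp]
    exact (Spec _).presheaf.map_id _
  rw [Scheme.Hom.appLE, Scheme.fromSpecStalk_app hx]
  simp only [Category.assoc]
  rw [reassoc_of% this, Iso.inv_hom_id, Category.comp_id]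

lemma IsNormalisation.isIntegralHom {X' Y : Scheme.{u}} [IsIntegral Y] {ν : X' ⟶ Y}
    (h : IsNormalisation ν) : IsIntegralHom ν := by
  obtain ⟨e, rfl⟩ := h
  have : IsIntegralHom (fromNormalisation Y) :=
    inferInstanceAs (IsIntegralHom (fromSpecFunctionField Y).fromNormalization)
  infer_instance

/-- `Spec K(Y) ⟶ Y` factors through a scheme-theoretically dominant morphism to the normalisation
of `Y`. -/
lemma IsNormalisation.exists_isSchemeTheoreticallyDominant {X' Y : Scheme.{u}} [IsIntegral Y]
    {ν : X' ⟶ Y} (h : IsNormalisation ν) :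
    ∃ t : Spec Y.functionField ⟶ X', IsSchemeTheoreticallyDominant t ∧ QuasiCompact t ∧
      t ≫ ν = fromSpecFunctionField Y := by
  obtain ⟨e, rfl⟩ := h
  let τ : Spec Y.functionField ⟶ normalisation Y := (fromSpecFunctionField Y).toNormalization
  have hτ : τ ≫ fromNormalisation Y = fromSpecFunctionField Y :=
    Scheme.Hom.toNormalization_fromNormalization _
  have : IsSchemeTheoreticallyDominant τ :=
    ⟨Scheme.Hom.ker_toNormalization (fromSpecFunctionField Y)⟩
  have : QuasiCompact τ := inferInstanceAs (QuasiCompact (fromSpecFunctionField Y).toNormalization)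
  exact ⟨τ ≫ e.inv, inferInstance, inferInstance, by simpa using hτ⟩

instance {Y : Scheme.{u}} [IsIntegral Y] : IsDominant (fromSpecFunctionField Y) := by
  refine ⟨dense_iff_closure_eq.mpr ?_⟩
  rw [← Set.univ_subset_iff, ← genericPoint_closure (α := Y)]
  apply closure_mono
  rw [Set.singleton_subset_iff]
  exact ⟨IsLocalRing.closedPoint _, Scheme.fromSpecStalk_closedPoint⟩

lemma IsNormalisation.isSchemeTheoreticallyDominant {X' Y : Scheme.{u}} [IsIntegral Y] {ν : X' ⟶ Y}
    (h : IsNormalisation ν) : IsSchemeTheoreticallyDominant ν := by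
  obtain ⟨t, -, -, ht⟩ := h.exists_isSchemeTheoreticallyDominant
  have : IsDominant (t ≫ ν) := ht ▸ inferInstance
  have : IsDominant ν := .of_comp t ν
  exact .of_isDominant ν

/-- The normalisation of a normal integral scheme is an isomorphism. -/
lemma IsNormalisation.isIso {X' Y : Scheme.{u}} [IsIntegral Y] {ν : X' ⟶ Y}
    (h : IsNormalisation ν) (hY : IsNormalScheme Y) : IsIso ν := by
  obtain ⟨t, h1, h2, h3⟩ := h.exists_isSchemeTheoreticallyDominant
  have := h.isIntegralHom
  have := h.isSchemeTheoreticallyDominant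
  rw [← MorphismProperty.isomorphisms.iff,
    IsZariskiLocalAtTarget.iff_of_iSup_eq_top (P := .isomorphisms Scheme.{u}) _
      (iSup_affineOpens_eq_top Y)]
  intro U
  rw [MorphismProperty.isomorphisms.iff, isIso_morphismRestrict_iff_isIso_app ν U.2,
    ConcreteCategory.isIso_iff_bijective]
  refine ⟨ν.app_injective U, fun b ↦ ?_⟩
  by_cases hne : Nonempty U.1
  · have := hY.isIntegrallyClosed U.2
    have := functionField_isFractionRing_of_isAffineOpen Y U.1 U.2
    have hg : genericPoint Y ∈ U.1 :=
      ((genericPoint_spec Y).mem_open_set_iff U.1.isOpen).mpr (by simpa using hne)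
    have hU : ⊤ ≤ t ⁻¹ᵁ ν ⁻¹ᵁ U.1 := by
      rintro x -
      have : fromSpecFunctionField Y x = genericPoint Y := by
        rw [Subsingleton.elim (α := PrimeSpectrum Y.functionField) x (IsLocalRing.closedPoint _)]
        exact Scheme.fromSpecStalk_closedPoint
      change (t ≫ ν) x ∈ U.1
      rwa [h3, this]
    -- `r` embeds the sections of `X'` in `K(Y)`, since `t` is scheme-theoretically dominant. Their
    -- images are integral over `Γ(Y, U)`, hence already lie in it.
    let r : Γ(X', ν ⁻¹ᵁ U.1) ⟶ Y.functionField :=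
      t.appLE (ν ⁻¹ᵁ U.1) ⊤ hU ≫ (Scheme.ΓSpecIso _).hom
    have hr : Function.Injective r := by
      have : IsIso ((Spec Y.functionField).presheaf.map (homOfLE hU).op) := by
        have : IsIso (homOfLE hU) := homOfLE_isIso_of_eq _ (top_le_iff.mp hU).symm
        infer_instance
      have : Function.Injective (((Spec Y.functionField).presheaf.map (homOfLE hU).op) ≫
          (Scheme.ΓSpecIso _).hom) := (ConcreteCategory.bijective_of_isIso _).1
      exact this.comp (t.app_injective _)
    have hνr : ν.app U.1 ≫ r = Y.germToFunctionField U.1 := by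
      simp only [r, Scheme.Hom.app_eq_appLE, Scheme.Hom.appLE_comp_appLE_assoc, h3]
      exact fromSpecStalk_appLE hg _
    have hνr' (a) : r (ν.app U.1 a) = algebraMap Γ(Y, U.1) Y.functionField a :=
      congr($hνr a)
    have hb : IsIntegral Γ(Y, U.1) (r b) := by
      obtain ⟨q, hq, hqb⟩ := ν.isIntegral_app U.1 U.2 b
      refine ⟨q, hq, ?_⟩
      have h4 : algebraMap Γ(Y, U.1) Y.functionField = r.hom.comp (ν.app U.1).hom :=
        congr($(hνr.symm).hom)
      rw [h4, ← Polynomial.hom_eval₂, hqb, map_zero]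
    obtain ⟨a, ha⟩ := IsIntegrallyClosed.isIntegral_iff.mp hb
    exact ⟨a, hr (by rw [hνr', ha])⟩
  · have hU : ν ⁻¹ᵁ U.1 = ⊥ := by
      rw [eq_bot_iff]
      exact fun x hx ↦ hne ⟨ν x, hx⟩
    have : Subsingleton Γ(X', ν ⁻¹ᵁ U.1) := by
      rw [hU]
      infer_instance
    exact ⟨0, Subsingleton.elim _ _⟩

/-! ### Global sections and the proper case -/

lemma le_preimage_top {X Y : Scheme.{u}} (f : X ⟶ Y) (U : X.Opens) : U ≤ f ⁻¹ᵁ ⊤ := by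
  simp

lemma appLE_top_top {X Y : Scheme.{u}} (f : X ⟶ Y) (h : ⊤ ≤ f ⁻¹ᵁ ⊤) :
    f.appLE ⊤ ⊤ h = f.appTop := by
  rw [Scheme.Hom.appTop, Scheme.Hom.app_eq_appLE]
  rfl

/-- The sections over the preimage of an affine open in a base change of fields. -/
lemma isPushout_baseChange {k l : Type u} [Field k] [Field l] [Algebra k l]
    {X : Scheme.{u}} (α : X ⟶ Spec (.of k)) {U : X.Opens} (hU : IsCompact (U : Set X))
    (hU' : IsQuasiSeparated (U : Set X)) :
    IsPushout (α.appLE ⊤ U (le_preimage_top _ _))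
      (Spec.map (CommRingCat.ofHom (algebraMap k l))).appTop
      ((pullback.fst α (Spec.map (CommRingCat.ofHom (algebraMap k l)))).app U)
      ((pullback.snd α (Spec.map (CommRingCat.ofHom (algebraMap k l)))).appLE ⊤ _ (le_preimage_top _ _)) := by
  have := isIso_pushoutSection_of_isQuasiSeparated_of_flat_right
    (.of_hasPullback α (Spec.map (CommRingCat.ofHom (algebraMap k l))))
    (US := ⊤) (UT := ⊤) (UX := U) (le_preimage_top _ _) (le_preimage_top _ _)
    (UY := pullback.fst α (Spec.map (CommRingCat.ofHom (algebraMap k l))) ⁻¹ᵁ U)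
    (by rw [Scheme.Hom.preimage_top, inf_top_eq]) (isAffineOpen_top _) (isAffineOpen_top _) hU hU'
  have := (isIso_pushoutSection_iff _ _ _ _).mp this
  rw [appLE_top_top] at this
  rwa [Scheme.Hom.app_eq_appLE]

/-- `Γ(X, ⊤) = k` if `X` is universally closed over `k` and `k` is algebraically closed in `K(X)`. -/
lemma bijective_appTop_of_universallyClosed {k : Type u} [Field k] {X : Scheme.{u}}
    (α : X ⟶ Spec (.of k)) [UniversallyClosed α] (h : IsVarietyWithClosedBase α) :
    Function.Bijective α.appTop := by
  have := h.isIntegral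
  let g := (Scheme.ΓSpecIso (.of k)).inv ≫ α.appTop
  suffices hg : Function.Bijective g from
    (Function.Bijective.of_comp_iff _ (ConcreteCategory.bijective_of_isIso
      (Scheme.ΓSpecIso (.of k)).inv)).mp hg
  refine ⟨RingHom.injective (R := k) g.hom, fun s ↦ ?_⟩
  have hs : g.hom.IsIntegralElem s := by
    have : g.hom.IsIntegral := RingHom.isIntegral_respectsIso.2 α.appTop.hom
      (Scheme.ΓSpecIso (.of k)).symm.commRingCatIsoToRingEquiv
      (isIntegral_appTop_of_universallyClosed α)
    exact this s
  let γ := (X.presheaf.germ ⊤ (genericPoint X) trivial).hom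
  have hs' : γ s ∈ algClosureIn (toFunctionField α) := by
    let := (toFunctionField α).toAlgebra
    obtain ⟨q, hq, hqs⟩ := hs
    have : IsIntegral k (γ s) := ⟨q, hq, by
      change q.eval₂ (γ.comp g.hom) (γ s) = 0
      rw [← Polynomial.hom_eval₂, hqs, map_zero]⟩
    exact (mem_algebraicClosure_iff (F := k) (x := γ s)).mpr this.isAlgebraic
  rw [← h.algClosed] at hs'
  obtain ⟨x, hx⟩ := hs'
  exact ⟨x, germ_injective_of_isIntegral X (U := ⊤) _ trivial hx⟩

/-- If `X` is proper over `k` and `X ×ₖ l` is normal, then `l = k'`. -/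
lemma surjective_of_isNormalScheme_baseChange {p : ℕ} {k l k' : Type u} [Field k] [Field l]
    [Field k'] [Algebra k l] [Algebra l k'] {X X' : Scheme.{u}} {α : X ⟶ Spec (.of k)}
    {α' : X' ⟶ Spec (.of k')} {φ : X' ⟶ X} (h : IsElementalExtension p (l := l) α α' φ)
    [UniversallyClosed α] (hn : IsNormalScheme (baseChange α l)) :
    Function.Surjective (algebraMap l k') := by
  have := h.isIntegral_baseChange
  have := h.isNormalisation.isIso hn
  have := h.isNormalisation.isIntegral
  have := h.isVarietyWithClosedBase.quasiCompact
  have := h.isVarietyWithClosedBase.isSeparated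
  have : CompactSpace X := (quasiCompact_iff_compactSpace α).mp inferInstance
  have : QuasiSeparatedSpace X := (quasiSeparated_iff_quasiSeparatedSpace α).mp inferInstance
  have h1 := isPushout_baseChange (l := l) α (U := ⊤) isCompact_univ isQuasiSeparated_univ
  have h2 : IsIso (α.appLE ⊤ ⊤ (le_preimage_top _ _)) := by
    rw [appLE_top_top, ConcreteCategory.isIso_iff_bijective]
    exact bijective_appTop_of_universallyClosed α h.isVarietyWithClosedBase
  have h3 : IsIso (pullback.snd α (Spec.map (CommRingCat.ofHom (algebraMap k l)))).appTop := by
    have := h1.isIso_inr_of_isIso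
    exact (appLE_top_top (pullback.snd α _) (le_preimage_top _ _)) ▸ this
  have h4 : IsIso (α' ≫ Spec.map (CommRingCat.ofHom (algebraMap l k'))).appTop := by
    have h5 : pullback.lift φ (α' ≫ Spec.map (CommRingCat.ofHom (algebraMap l k'))) h.comm ≫
        pullback.snd _ _ = α' ≫ Spec.map (CommRingCat.ofHom (algebraMap l k')) :=
      pullback.lift_snd _ _ _
    have (f : X' ⟶ baseChange α l) [IsIso f] : IsIso f.appTop :=
      inferInstanceAs (IsIso (f.app ⊤))
    have := this (pullback.lift φ (α' ≫ Spec.map (CommRingCat.ofHom (algebraMap l k')))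
      h.comm)
    rw [← h5, Scheme.Hom.comp_appTop]
    infer_instance
  -- The composite `l → k' → Γ(X')` is bijective and its second map is injective, so the first is
  -- surjective.
  let g := (Scheme.ΓSpecIso (.of k')).inv ≫ α'.appTop
  have h5 : Function.Injective g := RingHom.injective (R := k') g.hom
  have h6 : CommRingCat.ofHom (algebraMap l k') ≫ g =
      (Scheme.ΓSpecIso (.of l)).inv ≫
        (α' ≫ Spec.map (CommRingCat.ofHom (algebraMap l k'))).appTop := by
    simp [g]
  have h7 : IsIso (CommRingCat.ofHom (algebraMap l k') ≫ g) := h6 ▸ inferInstance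
  intro x
  obtain ⟨y, hy⟩ := (ConcreteCategory.bijective_of_isIso (CommRingCat.ofHom (algebraMap l k') ≫ g)).2
    (g x)
  exact ⟨y, h5 hy⟩

/-! ### Function fields of base changes -/

lemma fromSpecFunctionField_comp {k : Type u} [Field k] {X : Scheme.{u}} [IsIntegral X]
    (α : X ⟶ Spec (.of k)) :
    fromSpecFunctionField X ≫ α = Spec.map (CommRingCat.ofHom (toFunctionField α)) := by
  apply ext_of_isAffine
  rw [Scheme.Hom.comp_appTop, ← cancel_mono (Scheme.ΓSpecIso _).hom, Category.assoc,
    Scheme.ΓSpecIso_naturality, ← appLE_top_top (fromSpecFunctionField X) (le_preimage_top _ _),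
    fromSpecStalk_appLE (U := ⊤) trivial, ← Iso.inv_comp_eq]
  rfl

lemma toFunctionField_comp_specMap {k l : Type u} [Field k] [Field l] {X : Scheme.{u}}
    [IsIntegral X] (α : X ⟶ Spec (.of k)) (f : l →+* k) :
    toFunctionField (α ≫ Spec.map (CommRingCat.ofHom f)) = (toFunctionField α).comp f := by
  have := fromSpecFunctionField_comp (α ≫ Spec.map (CommRingCat.ofHom f))
  rw [← Category.assoc, fromSpecFunctionField_comp, ← Spec.map_comp, ← CommRingCat.ofHom_comp] at this
  exact congr($(Spec.map_injective this.symm).hom)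

/-- The map on function fields induced by a surjective morphism of integral schemes. -/
lemma exists_functionField_hom {X Y : Scheme.{u}} [IsIntegral X] [IsIntegral Y] (f : Y ⟶ X)
    [Surjective f] :
    ∃ a : X.functionField ⟶ Y.functionField,
      Spec.map a ≫ fromSpecFunctionField X = fromSpecFunctionField Y ≫ f ∧
      ∀ (U : X.Opens) (hX : genericPoint X ∈ U) (hY : genericPoint Y ∈ f ⁻¹ᵁ U),
        X.presheaf.germ U _ hX ≫ a = f.app U ≫ Y.presheaf.germ _ _ hY := by
  have hf : f (genericPoint Y) ⤳ genericPoint X := by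
    have := (genericPoint_spec Y).image f.continuous
    rw [Set.image_univ, f.surjective.range_eq, closure_univ] at this
    rw [this.eq (genericPoint_spec X)]
  refine ⟨X.presheaf.stalkSpecializes hf ≫ f.stalkMap (genericPoint Y), ?_, fun U hX hY ↦ ?_⟩
  · rw [Spec.map_comp, Category.assoc, Scheme.SpecMap_stalkSpecializes_fromSpecStalk,
      Scheme.SpecMap_stalkMap_fromSpecStalk]
  · rw [TopCat.Presheaf.germ_stalkSpecializes_assoc, Scheme.Hom.germ_stalkMap]

/-- The universal property gives a map `C ⟶ S` whose composite with the inclusion is the identity.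
-/
lemma eq_top_of_isPushout {R A B C : CommRingCat.{u}} {f : R ⟶ A} {g : R ⟶ B} {i : A ⟶ C}
    {j : B ⟶ C} (h : IsPushout f g i j) (S : Subring C) (hi : ∀ x, i x ∈ S) (hj : ∀ x, j x ∈ S) :
    S = ⊤ := by
  let i' : A ⟶ .of S := CommRingCat.ofHom (i.hom.codRestrict S hi)
  let j' : B ⟶ .of S := CommRingCat.ofHom (j.hom.codRestrict S hj)
  have hw : f ≫ i' = g ≫ j' := by
    refine CommRingCat.hom_ext (RingHom.ext fun x ↦ Subtype.ext ?_)
    exact (ConcreteCategory.congr_hom h.w x :)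
  have hd : h.desc i' j' hw ≫ CommRingCat.ofHom S.subtype = 𝟙 C := by
    apply h.hom_ext
    · rw [h.inl_desc_assoc, Category.comp_id]; rfl
    · rw [h.inr_desc_assoc, Category.comp_id]; rfl
  rw [eq_top_iff]
  intro x _
  have := congr($hd x)
  rw [CommRingCat.id_apply] at this
  exact this ▸ (h.desc i' j' hw x).2

lemma IsElementalExtension.isAlgebraic {p : ℕ} {k l k' : Type u} [Field k] [Field l]
    [Field k'] [Algebra k l] [Algebra l k'] {X X' : Scheme.{u}} {α : X ⟶ Spec (.of k)}
    {α' : X' ⟶ Spec (.of k')} {φ : X' ⟶ X} (h : IsElementalExtension p (l := l) α α' φ) :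
    Algebra.IsAlgebraic l k' := by
  have := h.isIntegral_baseChange
  have := h.isNormalisation.isIntegral
  refine ⟨fun x ↦ ?_⟩
  have hx : toFunctionField α' x ∈ (toFunctionField α').fieldRange := ⟨x, rfl⟩
  rw [h.algClosure, toFunctionField_comp_specMap] at hx
  let := (toFunctionField α').toAlgebra
  let := ((toFunctionField α').comp (algebraMap l k')).toAlgebra
  have : IsScalarTower l k' X'.functionField := .of_algebraMap_eq' rfl
  have hx' : IsAlgebraic l (algebraMap k' X'.functionField x) :=
    (mem_algebraicClosure_iff (F := l) (E := X'.functionField)).mp hx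
  exact (isAlgebraic_algebraMap_iff (algebraMap k' X'.functionField).injective).mp hx'

/-- Geometric reducedness restricts to the generic point, and the tensor product is the coordinate
ring of the base change of `Spec K(X)`. -/
lemma isReduced_functionField_tensorProduct {k : Type u} [Field k] {X : Scheme.{u}} [IsIntegral X]
    (α : X ⟶ Spec (.of k)) [GeometricallyReduced α] (K : Type u) [Field K] [Algebra k K] :
    let := (toFunctionField α).toAlgebra
    _root_.IsReduced (X.functionField ⊗[k] K) := by
  intro _
  have h : GeometricallyReduced (fromSpecFunctionField X ≫ α) :=
    geometricallyReduced_comp_of_flat_of_isPreimmersion _ _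
  rw [fromSpecFunctionField_comp] at h
  have := (CommRingCat.isPushout_tensorProduct k X.functionField K).op.map Scheme.Spec
  have := h.geometrically_isReduced _ _ _ this.flip
  exact (affine_isReduced_iff _).mp this

/-- The function field of an integral base change `X ×ₖ l` with `l` algebraic over `k` is generated
by `l` over the function field of `X`. -/
lemma adjoin_range_toFunctionField_eq_top {k l : Type u} [Field k] [Field l] [Algebra k l]
    [Algebra.IsAlgebraic k l] {X : Scheme.{u}} [IsIntegral X] (α : X ⟶ Spec (.of k))
    [IsIntegral (baseChange α l)] (a : X.functionField ⟶ (baseChange α l).functionField)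
    (haα : a.hom.comp (toFunctionField α) = (toFunctionField (X := baseChange α l)
      (pullback.snd α (Spec.map (CommRingCat.ofHom (algebraMap k l))))).comp (algebraMap k l))
    (ha : ∀ (U : X.Opens) (hX : genericPoint X ∈ U) (hY : genericPoint (baseChange α l) ∈
      pullback.fst α (Spec.map (CommRingCat.ofHom (algebraMap k l))) ⁻¹ᵁ U),
      X.presheaf.germ U _ hX ≫ a =
        (pullback.fst α (Spec.map (CommRingCat.ofHom (algebraMap k l)))).app U ≫
          (baseChange α l).presheaf.germ _ _ hY) :
    let := a.hom.toAlgebra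
    Algebra.adjoin X.functionField (Set.range (toFunctionField (X := baseChange α l)
      (pullback.snd α (Spec.map (CommRingCat.ofHom (algebraMap k l)))))) = ⊤ := by
  intro _
  set π₁ : baseChange α l ⟶ X := pullback.fst _ _
  set π₂ : baseChange α l ⟶ Spec (.of l) := pullback.snd _ _
  obtain ⟨_, ⟨U, hU, rfl⟩, hηU, -⟩ :=
    X.isBasis_affineOpens.exists_subset_of_mem_open (Set.mem_univ (genericPoint X)) isOpen_univ
  have : Surjective π₁ := inferInstanceAs (Surjective (pullback.fst α _))
  obtain ⟨y, hy⟩ := π₁.surjective (genericPoint X)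
  have : Nonempty (π₁ ⁻¹ᵁ U) := ⟨⟨y, by
    change π₁ y ∈ U
    rwa [hy]⟩⟩
  have hη : genericPoint (baseChange α l) ∈ π₁ ⁻¹ᵁ U :=
    ((genericPoint_spec _).mem_open_set_iff (π₁ ⁻¹ᵁ U).isOpen).mpr (by simpa using this)
  have : IsAffineHom π₁ := by
    have : IsAffineHom (Spec.map (CommRingCat.ofHom (algebraMap k l))) := inferInstance
    exact MorphismProperty.of_isPullback (P := @IsAffineHom)
      (IsPullback.of_hasPullback α (Spec.map (CommRingCat.ofHom (algebraMap k l)))).flip this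
  have := functionField_isFractionRing_of_isAffineOpen (baseChange α l) (π₁ ⁻¹ᵁ U) (hU.preimage π₁)
  let S := Algebra.adjoin X.functionField (Set.range (toFunctionField π₂))
  let γ := (baseChange α l).presheaf.germ (π₁ ⁻¹ᵁ U) _ hη
  have hS : S.toSubring.comap γ.hom = ⊤ := by
    refine eq_top_of_isPushout (isPushout_baseChange α hU.isCompact hU.isQuasiSeparated) _
      (fun x ↦ ?_) (fun x ↦ ?_)
    · have := ConcreteCategory.congr_hom (ha U hηU hη) x
      change γ (π₁.app U x) ∈ S
      exact this ▸ S.algebraMap_mem (X.presheaf.germ U _ hηU x)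
    · apply Algebra.subset_adjoin
      refine ⟨(Scheme.ΓSpecIso (.of l)).hom x, ?_⟩
      have h1 : (Scheme.ΓSpecIso (.of l)).hom ≫ CommRingCat.ofHom (toFunctionField π₂) =
          π₂.appLE ⊤ (π₁ ⁻¹ᵁ U) (le_preimage_top _ _) ≫ γ := by
        rw [Scheme.Hom.appLE, Category.assoc, TopCat.Presheaf.germ_res, ← Iso.eq_inv_comp]
        rfl
      exact ConcreteCategory.congr_hom h1 x
  have hint : ∀ x ∈ Set.range (toFunctionField π₂), IsAlgebraic X.functionField x := by
    rintro _ ⟨x, rfl⟩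
    let _ : Algebra k X.functionField := (toFunctionField α).toAlgebra
    let _ : Algebra l (baseChange α l).functionField := (toFunctionField π₂).toAlgebra
    let _ : Algebra k (baseChange α l).functionField :=
      ((toFunctionField π₂).comp (algebraMap k l)).toAlgebra
    have : IsScalarTower k X.functionField (baseChange α l).functionField :=
      .of_algebraMap_eq' haα.symm
    have : IsScalarTower k l (baseChange α l).functionField := .of_algebraMap_eq' rfl
    have : IsAlgebraic k (algebraMap l (baseChange α l).functionField x) :=
      (Algebra.IsAlgebraic.isAlgebraic (R := k) x).algebraMap
    exact this.tower_top X.functionField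
  -- As the generators are algebraic, the algebra they generate is a field; it therefore contains
  -- all fractions of the sections over `π₁ ⁻¹ᵁ U`.
  have hS' := IntermediateField.adjoin_toSubalgebra_of_isAlgebraic hint
  rw [← hS', eq_top_iff]
  intro x _
  obtain ⟨c, d, -, rfl⟩ := IsFractionRing.div_surjective (A := Γ(baseChange α l, π₁ ⁻¹ᵁ U)) x
  have key (c : Γ(baseChange α l, π₁ ⁻¹ᵁ U)) : γ c ∈ IntermediateField.adjoin X.functionField
      (Set.range (toFunctionField π₂)) := by
    rw [← IntermediateField.mem_toSubalgebra, hS']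
    exact (hS ▸ trivial : c ∈ S.toSubring.comap γ.hom)
  have := div_mem (key c) (key d)
  exact this

/-- If `X` is geometrically reduced over `k`, then `l = k'`. -/
lemma surjective_of_geometricallyReduced {p : ℕ} [Fact p.Prime] {k l k' : Type u} [Field k]
    [CharP k p] [Field l] [Field k'] [Algebra k l] [Algebra l k'] {X X' : Scheme.{u}}
    {α : X ⟶ Spec (.of k)} {α' : X' ⟶ Spec (.of k')} {φ : X' ⟶ X}
    (h : IsElementalExtension p (l := l) α α' φ) [GeometricallyReduced α] :
    Function.Surjective (algebraMap l k') := by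
  have := h.isVarietyWithClosedBase.isIntegral
  have := h.isIntegral_baseChange
  let π₁ : baseChange α l ⟶ X := pullback.fst _ _
  let π₂ : baseChange α l ⟶ Spec (.of l) := pullback.snd _ _
  obtain ⟨t, -, -, ht⟩ := h.isNormalisation.exists_isSchemeTheoreticallyDominant
  obtain ⟨a, ha, ha'⟩ := exists_functionField_hom π₁
  -- Going through `t` embeds `k'` directly in `K(X ×ₖ l)`, so `K(X')` need not be identified with
  -- it.
  let β : CommRingCat.of k' ⟶ (baseChange α l).functionField := Spec.preimage (t ≫ α')
  have hβ : β.hom.comp (algebraMap l k') = toFunctionField π₂ := by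
    have h1 : CommRingCat.ofHom (algebraMap l k') ≫ β =
        CommRingCat.ofHom (toFunctionField π₂) := by
      apply Spec.map_injective
      rw [← fromSpecFunctionField_comp, Spec.map_comp, Spec.map_preimage, Category.assoc, ← ht,
        Category.assoc]
      exact congr(t ≫ $((pullback.lift_snd _ _ h.comm).symm))
    exact congr($(h1).hom)
  have haα : a.hom.comp (toFunctionField α) = (toFunctionField π₂).comp (algebraMap k l) := by
    have h1 : CommRingCat.ofHom (toFunctionField α) ≫ a =
        CommRingCat.ofHom (algebraMap k l) ≫ CommRingCat.ofHom (toFunctionField π₂) := by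
      apply Spec.map_injective
      rw [Spec.map_comp, Spec.map_comp, ← fromSpecFunctionField_comp, ← fromSpecFunctionField_comp,
        reassoc_of% ha, Category.assoc]
      exact congr(fromSpecFunctionField (baseChange α l) ≫ $(pullback.condition))
    exact congr($(h1).hom)
  let _ : Algebra k k' := ((algebraMap l k').comp (algebraMap k l)).toAlgebra
  let _ : Algebra k X.functionField := (toFunctionField α).toAlgebra
  let _ : Algebra X.functionField (baseChange α l).functionField := a.hom.toAlgebra
  let _ : Algebra k' (baseChange α l).functionField := β.hom.toAlgebra
  let _ : Algebra l (baseChange α l).functionField := (toFunctionField π₂).toAlgebra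
  let _ : Algebra k (baseChange α l).functionField :=
    ((toFunctionField π₂).comp (algebraMap k l)).toAlgebra
  have : IsScalarTower k l k' := .of_algebraMap_eq' rfl
  have : IsScalarTower k X.functionField (baseChange α l).functionField :=
    .of_algebraMap_eq' haα.symm
  have : IsScalarTower l k' (baseChange α l).functionField := .of_algebraMap_eq' hβ.symm
  have : IsScalarTower k k' (baseChange α l).functionField := .of_algebraMap_eq' <| by
    change (toFunctionField π₂).comp (algebraMap k l) =
      β.hom.comp ((algebraMap l k').comp (algebraMap k l))
    rw [← RingHom.comp_assoc, hβ]
  have := h.isAlgebraic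
  have := isReduced_functionField_tensorProduct α k'
  refine algebraMap_surjective_of_isReduced_tensorProduct p (k := k) (K := X.functionField)
    (F := (baseChange α l).functionField) ?_ h.pow_mem fun x hx ↦ ?_
  · have : Algebra.IsAlgebraic k l := h.isPurelyInseparable.isAlgebraic
    exact adjoin_range_toFunctionField_eq_top α a haα ha'
  · have : x ∈ (toFunctionField α).fieldRange := by
      rw [h.isVarietyWithClosedBase.algClosed]
      exact (mem_algebraicClosure_iff (F := k) (E := X.functionField)).mpr hx
    exact this

/-! ### Passing between `X` and `X'` -/

lemma GeometricallyNormal.geometricallyReduced {k : Type u} [Field k] {X : Scheme.{u}}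
    {α : X ⟶ Spec (.of k)} (h : GeometricallyNormal α) : GeometricallyReduced α :=
  ⟨fun _ _ _ _ _ _ hZ ↦ (h _ _ _ hZ).isReduced⟩

lemma isIso_specMap_algebraMap {l k' : Type u} [Field l] [Field k'] [Algebra l k']
    (h : Function.Surjective (algebraMap l k')) :
    IsIso (Spec.map (CommRingCat.ofHom (algebraMap l k'))) := by
  have : IsIso (CommRingCat.ofHom (algebraMap l k')) :=
    (ConcreteCategory.isIso_iff_bijective _).mpr ⟨(algebraMap l k').injective, h⟩
  infer_instance

/-- If `X ×ₖ l` is normal and `l = k'`, then `α' : X' ⟶ Spec k'` is isomorphic to the base change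
of `α`. -/
lemma IsElementalExtension.iff_snd {p : ℕ} {k l k' : Type u} [Field k] [Field l] [Field k']
    [Algebra k l] [Algebra l k'] {X X' : Scheme.{u}} {α : X ⟶ Spec (.of k)}
    {α' : X' ⟶ Spec (.of k')} {φ : X' ⟶ X} (h : IsElementalExtension p (l := l) α α' φ)
    (hn : IsNormalScheme (baseChange α l)) (hs : Function.Surjective (algebraMap l k'))
    (P : MorphismProperty Scheme.{u}) [P.RespectsIso] :
    P α' ↔ P (pullback.snd α (Spec.map (CommRingCat.ofHom (algebraMap k l)))) := by
  have := h.isIntegral_baseChange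
  have h1 := h.isNormalisation.isIso hn
  have h2 := isIso_specMap_algebraMap hs
  rw [← P.cancel_right_of_respectsIso α' (Spec.map (CommRingCat.ofHom (algebraMap l k'))),
    ← pullback.lift_snd _ _ h.comm]
  exact P.cancel_left_of_respectsIso _ _

lemma geometricallyNormal_iff {p : ℕ} {k l k' : Type u} [Field k] [Field l] [Field k']
    [Algebra k l] [Algebra l k'] {X X' : Scheme.{u}} {α : X ⟶ Spec (.of k)}
    {α' : X' ⟶ Spec (.of k')} {φ : X' ⟶ X} (h : IsElementalExtension p (l := l) α α' φ)
    (hn : IsNormalScheme (baseChange α l)) (hs : Function.Surjective (algebraMap l k')) :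
    GeometricallyNormal α' ↔ GeometricallyNormal α := by
  refine (h.iff_snd hn hs (geometrically fun Y ↦ IsNormalScheme Y)).trans ⟨fun H ↦ ?_, fun H ↦ ?_⟩
  · exact geometrically_of_geometrically_snd (P := fun Y ↦ IsNormalScheme Y)
      (fun f _ _ ↦ IsNormalScheme.of_flat_of_surjective f) α H
  · exact MorphismProperty.of_isPullback (IsPullback.of_hasPullback _ _) H

/-- The composite `Spec K(X ×ₖ l) ⟶ X' ⟶ X ×ₖ l` has both factors scheme-theoretically dominant. The
second carries reducedness down from `X'`; restricting to the generic point and using the first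
carries it up. -/
lemma geometricallyReduced_iff {p : ℕ} {k l k' : Type u} [Field k] [Field l] [Field k']
    [Algebra k l] [Algebra l k'] {X X' : Scheme.{u}} {α : X ⟶ Spec (.of k)}
    {α' : X' ⟶ Spec (.of k')} {φ : X' ⟶ X} (h : IsElementalExtension p (l := l) α α' φ)
    (hs : Function.Surjective (algebraMap l k')) :
    GeometricallyReduced α' ↔ GeometricallyReduced α := by
  have := h.isIntegral_baseChange
  have := h.isNormalisation.isSchemeTheoreticallyDominant
  have := h.isNormalisation.isIntegralHom
  obtain ⟨t, _, _, ht⟩ := h.isNormalisation.exists_isSchemeTheoreticallyDominant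
  have h2 := isIso_specMap_algebraMap hs
  let π₂ : baseChange α l ⟶ Spec (.of l) := pullback.snd _ _
  have h3 : _ = α' ≫ _ := pullback.lift_snd _ _ h.comm
  have : MorphismProperty.RespectsIso @GeometricallyReduced :=
    MorphismProperty.IsStableUnderBaseChange.respectsIso
  have h4 := MorphismProperty.cancel_right_of_respectsIso @GeometricallyReduced α'
    (Spec.map (CommRingCat.ofHom (algebraMap l k')))
  rw [← h4]
  refine ⟨fun H ↦ ?_, fun H ↦ ?_⟩
  · rw [← h3] at H
    have : GeometricallyReduced π₂ := geometricallyReduced_of_isSchemeTheoreticallyDominant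
      (pullback.lift φ (α' ≫ Spec.map (CommRingCat.ofHom (algebraMap l k'))) h.comm :
      X' ⟶ baseChange α l) π₂
    exact ⟨geometrically_of_geometrically_snd (P := fun Y ↦ IsReduced Y)
      (fun f _ _ _ ↦ isReduced_of_flat_of_surjective f) α this.1⟩
  · have : GeometricallyReduced π₂ :=
      MorphismProperty.of_isPullback (IsPullback.of_hasPullback _ _) H
    have h5 : GeometricallyReduced (fromSpecFunctionField (baseChange α l) ≫ π₂) :=
      geometricallyReduced_comp_of_flat_of_isPreimmersion _ _
    rw [← ht, Category.assoc] at h5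
    have h6 : GeometricallyReduced
      (t ≫ α' ≫ Spec.map (CommRingCat.ofHom (algebraMap l k'))) := h3 ▸ h5
    exact geometricallyReduced_of_isSchemeTheoreticallyDominant t _

end ElementalExt

end

/-! ### Induction along the tower -/

theorem mainTheorem5 (p : ℕ) [Fact p.Prime] (n : ℕ)
    (k : Fin (n + 1) → Type u) [∀ i, Field (k i)] [CharP (k 0) p]
    (l : Fin n → Type u) [∀ i, Field (l i)]
    [∀ i, Algebra (k i.castSucc) (l i)] [∀ i, Algebra (l i) (k i.succ)]
    (X : Fin (n + 1) → Scheme.{u}) (α : ∀ i, X i ⟶ Spec (.of (k i)))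
    (φ : ∀ i : Fin n, X i.succ ⟶ X i.castSucc)
    (hX : ElementalExt.IsNormalScheme (X 0))
    (hα : ElementalExt.IsVarietyWithClosedBase (α 0))
    (hφ : ∀ i : Fin n, ElementalExt.IsElementalExtension p (l := l i)
      (α i.castSucc) (α i.succ) (φ i)) :
    (ElementalExt.GeometricallyNormal (α (Fin.last n)) →
      (ElementalExt.GeometricallyNormal (α 0) ↔
        ∀ i : Fin n,
          ElementalExt.IsNormalScheme (ElementalExt.baseChange (α i.castSucc) (l i)) ∧
          Function.Bijective (algebraMap (l i) (k i.succ))) ∧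
      (IsProper (α 0) →
        ((ElementalExt.GeometricallyNormal (α 0) ↔
          ∀ i : Fin n,
            ElementalExt.IsNormalScheme (ElementalExt.baseChange (α i.castSucc) (l i))) ∧
        ((∀ i : Fin n,
          ElementalExt.IsNormalScheme (ElementalExt.baseChange (α i.castSucc) (l i)) ∧
          Function.Bijective (algebraMap (l i) (k i.succ))) ↔
          ∀ i : Fin n,
            ElementalExt.IsNormalScheme (ElementalExt.baseChange (α i.castSucc) (l i)))))) ∧
    (GeometricallyReduced (α (Fin.last n)) →
      (GeometricallyReduced (α 0) ↔
        ∀ i : Fin n, Function.Bijective (algebraMap (l i) (k i.succ)))) := by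
  have hchar (i) : CharP (k i) p := by
    induction i using Fin.induction with
    | zero => infer_instance
    | succ i ih =>
      exact charP_of_injective_ringHom
        ((algebraMap (l i) (k i.succ)).comp (algebraMap (k i.castSucc) (l i))).injective p
  have hbij (i : Fin n) (h : Function.Surjective (algebraMap (l i) (k i.succ))) :
      Function.Bijective (algebraMap (l i) (k i.succ)) := ⟨RingHom.injective _, h⟩
  have hab : ElementalExt.GeometricallyNormal (α 0) → ∀ i : Fin n,
      ElementalExt.IsNormalScheme (ElementalExt.baseChange (α i.castSucc) (l i)) ∧
      Function.Bijective (algebraMap (l i) (k i.succ)) := by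
    intro h0
    have step (i : Fin n) (hi : ElementalExt.GeometricallyNormal (α i.castSucc)) :
        ElementalExt.IsNormalScheme (ElementalExt.baseChange (α i.castSucc) (l i)) ∧
        Function.Bijective (algebraMap (l i) (k i.succ)) := by
      have := hi.geometricallyReduced
      exact ⟨pullback_of_geometrically hi _ _,
        hbij i (ElementalExt.surjective_of_geometricallyReduced (hφ i))⟩
    have hall (i) : ElementalExt.GeometricallyNormal (α i) := by
      induction i using Fin.induction with
      | zero => exact h0
      | succ i ih =>
        exact (ElementalExt.geometricallyNormal_iff (hφ i) (step i ih).1 (step i ih).2.2).mpr ih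
    exact fun i ↦ step i (hall _)
  have hba : ElementalExt.GeometricallyNormal (α (Fin.last n)) → (∀ i : Fin n,
      ElementalExt.IsNormalScheme (ElementalExt.baseChange (α i.castSucc) (l i)) ∧
      Function.Bijective (algebraMap (l i) (k i.succ))) →
      ElementalExt.GeometricallyNormal (α 0) := by
    intro hn h
    have hall (i) : ElementalExt.GeometricallyNormal (α i) := by
      induction i using Fin.reverseInduction with
      | last => exact hn
      | cast i ih =>
        exact (ElementalExt.geometricallyNormal_iff (hφ i) (h i).1 (h i).2.2).mp ih
    exact hall 0
  have hcb : IsProper (α 0) → (∀ i : Fin n,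
      ElementalExt.IsNormalScheme (ElementalExt.baseChange (α i.castSucc) (l i))) →
      ∀ i : Fin n, ElementalExt.IsNormalScheme (ElementalExt.baseChange (α i.castSucc) (l i)) ∧
      Function.Bijective (algebraMap (l i) (k i.succ)) := by
    intro h0 h
    have : MorphismProperty.RespectsIso @UniversallyClosed :=
      MorphismProperty.IsStableUnderBaseChange.respectsIso
    -- Universal closedness is the part of properness that `Γ(X) = k` needs; it climbs the tower
    -- because each `X'` is a base change of `X` here.
    have hall (i) : UniversallyClosed (α i) := by
      induction i using Fin.induction with
      | zero => infer_instance
      | succ i ih =>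
        rw [(hφ i).iff_snd (h i)
          (ElementalExt.surjective_of_isNormalScheme_baseChange (hφ i) (h i)) @UniversallyClosed]
        exact MorphismProperty.of_isPullback (IsPullback.of_hasPullback _ _) ih
    exact fun i ↦ ⟨h i, hbij i (have := hall i.castSucc
      ElementalExt.surjective_of_isNormalScheme_baseChange (hφ i) (h i))⟩
  refine ⟨fun hn ↦ ⟨⟨hab, hba hn⟩, fun hp ↦ ⟨⟨fun h i ↦ (hab h i).1, fun h ↦ hba hn (hcb hp h)⟩,
    ⟨fun h i ↦ (h i).1, hcb hp⟩⟩⟩, fun hn ↦ ⟨fun h0 ↦ ?_, fun h ↦ ?_⟩⟩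
  · have hall (i) : GeometricallyReduced (α i) := by
      induction i using Fin.induction with
      | zero => exact h0
      | succ i ih =>
        exact (ElementalExt.geometricallyReduced_iff (hφ i)
          (ElementalExt.surjective_of_geometricallyReduced (hφ i))).mpr ih
    exact fun i ↦ hbij i (have := hall i.castSucc
      ElementalExt.surjective_of_geometricallyReduced (hφ i))
  · have hall (i) : GeometricallyReduced (α i) := by
      induction i using Fin.reverseInduction with
      | last => exact hn
      | cast i ih => exact (ElementalExt.geometricallyReduced_iff (hφ i) (h i).2).mp ih
    exact hall 0
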